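/- Let $\Omega\subset\mathbb R^d$ ($d=2,3$) be a bounded domain, $X=H^1_0(\Omega)^d$, $(\cdot,\cdot)$ and $\|\cdot\|$ the $L^2(\Omega)$ inner product and norm, and $$b^*(u,v,w)=\tfrac12(u\cdot\nabla v,w)-\tfrac12(u\cdot\nabla w,v),\qquad u,v,w\in X .$$ There is a constant $M>0$ with $|b^*(u,v,w)|\le M\|\nabla u\|\|\nabla v\|\|\nabla w\|$ for all $u,v,w\in X$; fix any such $M$. Let $X_h\subset X$ and $Q_h\subset L^2_0(\Omega)$ be finite-dimensional subspaces satisfying the LBB condition, that is, for some $\beta>0$, $\sup_{0\ne v\in X_h}\frac{(\nabla\cdot v,q)}{\|q\|\|\nabla v\|}\ge\beta$ for all $0\ne q\in Q_h$, and let $V_h=\{v\in X_h:(\nabla\cdot v,q)=0\ \ \forall q\in Q_h\}$. Let $\nu>0$, $f\in X'$, $\|f\|_{-1}=\sup_{0\neq v\in X}|\langle f,v\rangle|/\|\nabla v\|$, and assume the small data condition $\kappa:=M\nu^{-2}\|f\|_{-1}<1$. The Picard operator $G:V_h\to V_h$ is defined by $$b^*(w,G(w),v)+\nu(\nabla G(w),\nabla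 v)=\langle f,v\rangle\qquad\forall v\in V_h .$$ The Anderson-accelerated Picard iteration of depth $m=2$ starts from any $u_0\in V_h$; for $k=0,1,2,\dots$, with $m_k=\min\{k,2\}$, it sets $\tilde u_{k+1}=G(u_k)$ and $w_k=\tilde u_{k+1}-u_k$, chooses coefficients $\alpha^{k+1}_j$, $k-m_k\le j\le k$, minimizing $\big\|\nabla\sum_{j}\alpha_j w_j\big\|$ subject to $\sum_j\alpha_j=1$, and sets $u_{k+1}=\sum_j\alpha^{k+1}_j\tilde u_{j+1}$. The gain $\theta_{k+1}\in[0,1]$ of the step computing $u_{k+1}$ is defined by $$\min_{\sum_j\alpha_j=1}\Big\|\nabla\sum_{j=k-m_k}^k\alpha_jw_j\Big\|=\theta_{k+1}\|\nabla w_k\| .$$ **Theorem 4.2.** For all $\bar\alpha$ and all $\breve\alpha>0$ there is a constant $C$, depending only on $M,\nu,\kappa,\bar\alpha,\breve\alpha$, such that on any step $k\ge2$ at which $|\alpha^{k+1}_j|\le\bar\alpha$ for $j=k-2,k-1,k$, $|\alpha^{k+1}_k|>\breve\alpha$, $\alpha^{k+1}_k>\alpha^{k+1}_{k-2}$, and at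 least one of $\alpha^{k+1}_{k-2},\alpha^{k+1}_{k-1}$ is nonzero, $$\|\nabla w_{k+1}\|\le\kappa\,\theta_{k+1}\|\nabla w_k\|+C\max\{\|\nabla w_{k-2}\|,\|\nabla w_{k-1}\|\}^2 .$$ In particular, whenever $\|\nabla w_{k-1}\|\le K\|\nabla w_{k-2}\|$ with $K\ge1$, $$\|\nabla w_{k+1}\|\le\kappa\,\theta_{k+1}\|\nabla w_k\|+C K^2\|\nabla w_{k-2}\|^2 ,$$ so that the remainder is $\mathcal O(\|\nabla w_{k-2}\|^2)$. -/

import Mathlib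

open MeasureTheory

noncomputable section

namespace SteadyNSE

/-- The Euclidean space `ℝ^d`. -/
abbrev E (d : ℕ) : Type := EuclideanSpace ℝ (Fin d)

/-- `d × d` matrices with the Frobenius norm; the `(i, j)` entry of a gradient is `∂_j v_i`. -/
abbrev Mat (d : ℕ) : Type := EuclideanSpace ℝ (Fin d × Fin d)

variable {d : ℕ}

/-- `L²(Ω)`, vector valued. -/
abbrev L2Vec (Ω : Set (E d)) : Type := Lp (E d) 2 (volume.restrict Ω)

/-- `L²(Ω)`, matrix valued. -/
abbrev L2Mat (Ω : Set (E d)) : Type := Lp (Mat d) 2 (volume.restrict Ω)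

/-- `L²(Ω)`, scalar valued. -/
abbrev L2Scal (Ω : Set (E d)) : Type := Lp ℝ 2 (volume.restrict Ω)

/-- The classical gradient `(∂_j φ_i)_{ij}` of a vector field. -/
def classicalGrad (φ : E d → E d) (x : E d) : Mat d :=
  WithLp.toLp 2 fun ij => (fderiv ℝ φ x (EuclideanSpace.single ij.2 1)) ij.1

/-- The pairs `(φ, ∇φ)` in `L² × L²` for `φ ∈ C_c^∞(Ω; ℝ^d)`. -/
def testPairs (Ω : Set (E d)) : Set (L2Vec Ω × L2Mat Ω) :=
  {p | ∃ φ : E d → E d, ContDiff ℝ (⊤ : ℕ∞) φ ∧ HasCompactSupport φ ∧ tsupport φ ⊆ Ω ∧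
    p.1 =ᵐ[volume.restrict Ω] φ ∧ p.2 =ᵐ[volume.restrict Ω] classicalGrad φ}

/-- The velocity space `X = H¹₀(Ω; ℝ^d)`: the `H¹`-closure of `C_c^∞(Ω; ℝ^d)`, a field `u` being
recorded together with its weak gradient as `(u, ∇u) ∈ L² × L²`. -/
def H10 (Ω : Set (E d)) : Submodule ℝ (L2Vec Ω × L2Mat Ω) :=
  (Submodule.span ℝ (testPairs Ω)).topologicalClosure

variable {Ω : Set (E d)}

/-- The field `u` itself, as a function (defined almost everywhere). -/
def vel (u : H10 Ω) : E d → E d := u.1.1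

/-- The weak gradient `∇u`; its `L²` norm `‖grad u‖` is the paper's `‖∇u‖`. -/
def grad (u : H10 Ω) : L2Mat Ω := u.1.2

/-- `(u · ∇v, w) = ∫_Ω ∑_{i,j} u_j (∂_j v_i) w_i`. -/
def convection (u v w : H10 Ω) : ℝ :=
  ∫ x in Ω, ∑ i, ∑ j, vel u x j * grad v x (i, j) * vel w x i

/-- The skew-symmetric form `b*(u, v, w) = ½ (u · ∇v, w) - ½ (u · ∇w, v)`. -/
def bStar (u v w : H10 Ω) : ℝ :=
  1 / 2 * convection u v w - 1 / 2 * convection u w v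

/-- `M` is an admissible constant in `|b*(u, v, w)| ≤ M ‖∇u‖ ‖∇v‖ ‖∇w‖` on `X`. -/
def IsBStarBound (Ω : Set (E d)) (M : ℝ) : Prop :=
  ∀ u v w : H10 Ω, |bStar u v w| ≤ M * ‖grad u‖ * ‖grad v‖ * ‖grad w‖

/-- The dual norm `‖f‖_{-1} = sup_v |⟨f, v⟩| / ‖∇v‖` on `X'`. -/
def dualNorm (f : H10 Ω →L[ℝ] ℝ) : ℝ :=
  ⨆ v : H10 Ω, |f v| / ‖grad v‖

/-- `(∇ · v, q)`. -/
def divPairing (v : H10 Ω) (q : L2Scal Ω) : ℝ :=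
  ∫ x in Ω, (∑ i, grad v x (i, i)) * q x

/-- A pair of discrete velocity and pressure spaces `X_h ⊂ H¹₀(Ω)`, `Q_h ⊂ L²₀(Ω)` that satisfies
the inf-sup (LBB) condition. -/
structure IsDiscretePair (Xh : Submodule ℝ (H10 Ω)) (Qh : Submodule ℝ (L2Scal Ω)) : Prop where
  finite_vel : FiniteDimensional ℝ Xh
  finite_pres : FiniteDimensional ℝ Qh
  zero_mean : ∀ q ∈ Qh, ∫ x in Ω, q x = 0
  inf_sup : ∃ β : ℝ, 0 < β ∧ ∀ q ∈ Qh, q ≠ 0 →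
    β ≤ sSup {r : ℝ | ∃ v ∈ Xh, v ≠ 0 ∧ r = divPairing v q / (‖q‖ * ‖grad v‖)}

/-- The discretely divergence free velocities
`V_h = {v ∈ X_h | (∇ · v, q) = 0 for all q ∈ Q_h}`. -/
def discDivFree (Xh : Submodule ℝ (H10 Ω)) (Qh : Submodule ℝ (L2Scal Ω)) : Set (H10 Ω) :=
  {v | v ∈ Xh ∧ ∀ q ∈ Qh, divPairing v q = 0}

/-- `g = G(w)` for the Picard solution operator `G` on `V`: `g ∈ V` and
`b*(w, g, v) + ν (∇g, ∇v) = ⟨f, v⟩` for all `v ∈ V`. -/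
def IsPicardSolution (ν : ℝ) (f : H10 Ω →L[ℝ] ℝ) (V : Set (H10 Ω)) (w g : H10 Ω) : Prop :=
  g ∈ V ∧ ∀ v ∈ V, bStar w g v + ν * inner ℝ (grad g) (grad v) = f v

/-- The indices `k - m_k, …, k` with `m_k = min k m`. -/
def window (m k : ℕ) : Finset ℕ := Finset.Icc (k - min k m) k

/-- The Anderson accelerated Picard iteration of depth `m` on `V`, with iterates `u k`,
`ut (k + 1) = G (u k)` and optimization coefficients `α (k + 1) j`, `j = k - m_k, …, k`.
(`ut 0` and the values of `α` outside these ranges play no role.) -/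
structure IsAndersonPicard (m : ℕ) (ν : ℝ) (f : H10 Ω →L[ℝ] ℝ) (V : Set (H10 Ω))
    (u ut : ℕ → H10 Ω) (α : ℕ → ℕ → ℝ) : Prop where
  init : u 0 ∈ V
  picard : ∀ k, IsPicardSolution ν f V (u k) (ut (k + 1))
  sum_one : ∀ k, ∑ j ∈ window m k, α (k + 1) j = 1
  optimal : ∀ k, ∀ a : ℕ → ℝ, ∑ j ∈ window m k, a j = 1 →
    ‖grad (∑ j ∈ window m k, α (k + 1) j • (ut (j + 1) - u j))‖ ≤
      ‖grad (∑ j ∈ window m k, a j • (ut (j + 1) - u j))‖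
  update : ∀ k, u (k + 1) = ∑ j ∈ window m k, α (k + 1) j • ut (j + 1)

/-- `θ` is the gain of the optimization in step `k`, in which `u (k + 1)` is computed:
`min ‖∇ ∑ a_j (ut (j + 1) - u j)‖ = θ ‖∇ (ut (k + 1) - u k)‖`, the minimum being over all
coefficients with `∑ a_j = 1`. -/
def IsGain (m : ℕ) (u ut : ℕ → H10 Ω) (k : ℕ) (θ : ℝ) : Prop :=
  IsLeast {r : ℝ | ∃ a : ℕ → ℝ, ∑ j ∈ window m k, a j = 1 ∧
      r = ‖grad (∑ j ∈ window m k, a j • (ut (j + 1) - u j))‖}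
    (θ * ‖grad (ut (k + 1) - u k)‖)

end SteadyNSE

end

noncomputable section

namespace SteadyNSE

open Filter Topology
open scoped ENNReal NNReal

variable {d : ℕ} {Ω : Set (E d)}

/-! Let `U = ∑ a_j g_j` be the new iterate, with `g_j = G(u_j)`, `∑ a_j = 1`, `g = G(U)`, `z = g -
U` and `W = ∑ a_j (g_j - u_j)`. Subtracting the averaged Picard equations from the one for `g`,
tested with `z`, and using `b*(·, z, z) = 0`, gives `ν ‖∇z‖² = -b*(W, g, z) + ∑_{i<j} a_i a_j b*(u_i
- u_j, g_i - g_j, z)`: the average of a bilinear map differs from its value at the averages by a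
covariance of pairwise differences. Stability `ν ‖∇g‖ ≤ ‖f‖_{-1}` turns the first term into `κ
‖∇W‖`, and optimality makes `‖∇W‖` equal to `θ ‖∇w_k‖`. The other terms are quadratic: since `G`
contracts with factor `κ < 1`, `‖∇(u_i - u_j)‖` is at most `2 / (1 - κ)` times the larger residual.
Finally `w_k` is eliminated by solving `W = ∑ a_j w_j` for it, which needs `|a_k|` bounded below.
The analytic input is the Sobolev bound `‖u‖_{L⁴} ≤ C ‖∇u‖`, which makes `b*` a bounded trilinear
form and yields Poincaré. `norm_grad_residual_le` carries the argument. -/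

/-! ### Test fields and their gradients -/

theorem continuous_classicalGrad {φ : E d → E d} (hφ : ContDiff ℝ (⊤ : ℕ∞) φ) :
    Continuous (classicalGrad φ) := by
  have h := hφ.continuous_fderiv (by simp)
  refine (PiLp.continuous_toLp 2 _).comp (continuous_pi fun ij => ?_)
  have h1 : Continuous fun x => fderiv ℝ φ x (EuclideanSpace.single ij.2 1) :=
    h.clm_apply continuous_const
  exact (EuclideanSpace.proj ij.1 : E d →L[ℝ] ℝ).continuous.comp h1

/-- Cauchy–Schwarz in each row. It passes from the operator norm of the Sobolev inequality to the
Frobenius norm of `grad`. -/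
theorem norm_fderiv_le_norm_classicalGrad (φ : E d → E d) (x : E d) :
    ‖fderiv ℝ φ x‖ ≤ ‖classicalGrad φ x‖ := by
  refine ContinuousLinearMap.opNorm_le_bound _ (norm_nonneg _) fun y => ?_
  rw [← sq_le_sq₀ (norm_nonneg _) (by positivity), mul_pow, EuclideanSpace.real_norm_sq_eq,
    EuclideanSpace.real_norm_sq_eq, EuclideanSpace.real_norm_sq_eq, Fintype.sum_prod_type,
    Finset.sum_mul]
  refine Finset.sum_le_sum fun i _ => ?_
  have hy : (fderiv ℝ φ x y) i = ∑ j, classicalGrad φ x (i, j) * y j := by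
    have : y = ∑ j, y j • EuclideanSpace.single j (1 : ℝ) := by
      ext k
      simp [Finset.sum_apply, Pi.single_apply]
    conv_lhs => rw [this]
    simp [classicalGrad, mul_comm]
  rw [hy]
  exact Finset.sum_mul_sq_le_sq_mul_sq _ _ _

theorem classicalGrad_add {φ ψ : E d → E d} (hφ : Differentiable ℝ φ) (hψ : Differentiable ℝ ψ) :
    classicalGrad (φ + ψ) = classicalGrad φ + classicalGrad ψ := by
  ext x ij
  simp [classicalGrad, fderiv_add (hφ x) (hψ x)]

theorem classicalGrad_const_smul {φ : E d → E d} (hφ : Differentiable ℝ φ) (c : ℝ) :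
    classicalGrad (c • φ) = c • classicalGrad φ := by
  ext x ij
  simp [classicalGrad, fderiv_const_smul (hφ x)]

/-- Test pairs already form a subspace, so elements of `H10 Ω` are limits of genuine test pairs, not
just of their linear combinations. -/
theorem mem_testPairs_of_mem_span {p : L2Vec Ω × L2Mat Ω}
    (hp : p ∈ Submodule.span ℝ (testPairs Ω)) : p ∈ testPairs Ω := by
  induction hp using Submodule.span_induction with
  | mem p hp => exact hp
  | zero =>
    refine ⟨0, contDiff_const, HasCompactSupport.zero, by simp, Lp.coeFn_zero _ _ _, ?_⟩
    have : classicalGrad (0 : E d → E d) = 0 := by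
      ext x ij
      simp [classicalGrad]
    rw [this]
    exact Lp.coeFn_zero _ _ _
  | add p q _ _ hp hq =>
    obtain ⟨φ, h1, h2, h3, h4, h5⟩ := hp
    obtain ⟨ψ, k1, k2, k3, k4, k5⟩ := hq
    refine ⟨φ + ψ, h1.add k1, h2.add k2,
      (tsupport_add _ _).trans (Set.union_subset h3 k3), ?_, ?_⟩
    · exact (Lp.coeFn_add _ _).trans (h4.add k4)
    · rw [classicalGrad_add (h1.differentiable (by simp)) (k1.differentiable (by simp))]
      exact (Lp.coeFn_add _ _).trans (h5.add k5)
  | smul c p _ hp =>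
    obtain ⟨φ, h1, h2, h3, h4, h5⟩ := hp
    refine ⟨c • φ, h1.const_smul c, h2.smul_left (f := fun _ => c),
      (tsupport_smul_subset_right (fun _ => c) φ).trans h3, ?_, ?_⟩
    · exact (Lp.coeFn_smul _ _).trans (h4.const_smul c)
    · rw [classicalGrad_const_smul (h1.differentiable (by simp))]
      exact (Lp.coeFn_smul _ _).trans (h5.const_smul c)

/-! ### The Sobolev inequality in `L⁴` -/

/-- Exponents for the embedding of `W^{1,p}` in `L⁴`. The condition `p < d` excludes `p = 2` in the
plane; there `4/3` is the critical value, `3/4 - 1/2 = 1/4`. -/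
theorem exists_sobolev_exponent (hd : d = 2 ∨ d = 3) :
    ∃ p : ℝ≥0, 1 ≤ p ∧ p < d ∧ (p⁻¹ : ℝ) - (d : ℝ)⁻¹ ≤ ((4 : ℝ≥0) : ℝ)⁻¹ ∧ p ≤ 2 := by
  rcases hd with rfl | rfl
  · refine ⟨4 / 3, ?_, ?_, ?_, ?_⟩
    · rw [← NNReal.coe_le_coe]; norm_num
    · rw [← NNReal.coe_lt_coe]; norm_num
    · norm_num
    · rw [← NNReal.coe_le_coe]; norm_num
  · refine ⟨2, ?_, ?_, ?_, ?_⟩ <;> norm_num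

theorem isFiniteMeasure_restrict (hb : Bornology.IsBounded Ω) :
    IsFiniteMeasure (volume.restrict Ω) :=
  ⟨by simpa using hb.measure_lt_top⟩

theorem eLpNorm_restrict_eq_of_forall_notMem {α F : Type*} [MeasurableSpace α] {μ : Measure α}
    [NormedAddCommGroup F] {p : ℝ≥0∞} {f : α → F} {s : Set α} (hf : ∀ x ∉ s, f x = 0) :
    eLpNorm f p (μ.restrict s) = eLpNorm f p μ :=
  eLpNorm_restrict_eq_of_support_subset fun x hx => by_contra fun h => hx (hf x h)

/-- The Sobolev inequality `‖φ‖_{L⁴} ≤ C ‖∇φ‖_{L²}` for test fields. -/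
theorem exists_eLpNorm_four_le_of_testPairs (hd : d = 2 ∨ d = 3) (hb : Bornology.IsBounded Ω) :
    ∃ C : ℝ≥0, ∀ p ∈ testPairs Ω,
      eLpNorm p.1 4 (volume.restrict Ω) ≤ C * eLpNorm p.2 2 (volume.restrict Ω) := by
  have := isFiniteMeasure_restrict hb
  obtain ⟨s, hs1, hsd, hs4, hs2⟩ := exists_sobolev_exponent hd
  let A : ℝ≥0 := eLpNormLESNormFDerivOfLeConst (E d) (volume : Measure (E d)) Ω s 4
  -- The Hölder factor `|Ω|^{1/s - 1/2}` that bounds the `L^s` norm of the gradient by its `L²`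
  -- norm.
  let B : ℝ≥0∞ := (volume.restrict Ω) Set.univ ^
    (1 / (s : ℝ≥0∞).toReal - 1 / (2 : ℝ≥0∞).toReal)
  have hexp : 0 ≤ 1 / (s : ℝ≥0∞).toReal - 1 / (2 : ℝ≥0∞).toReal := by
    simp only [ENNReal.coe_toReal, ENNReal.toReal_ofNat, sub_nonneg]
    exact one_div_le_one_div_of_le (lt_of_lt_of_le one_pos (by exact_mod_cast hs1))
      (by exact_mod_cast hs2)
  have hB : B ≠ ∞ := ENNReal.rpow_ne_top_of_nonneg hexp (measure_ne_top _ _)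
  refine ⟨A * B.toNNReal, ?_⟩
  rintro p ⟨φ, hφ, hc, hsupp, h1, h2⟩
  rw [eLpNorm_congr_ae h1, eLpNorm_congr_ae h2]
  have hg := continuous_classicalGrad hφ
  have hsub : Function.support φ ⊆ Ω := (subset_tsupport φ).trans hsupp
  have hsub' : Function.support (fderiv ℝ φ) ⊆ Ω := (support_fderiv_subset ℝ).trans hsupp
  calc eLpNorm φ 4 (volume.restrict Ω) ≤ eLpNorm φ (4 : ℝ≥0) volume :=
        eLpNorm_mono_measure _ Measure.restrict_le_self
    _ ≤ A * eLpNorm (fderiv ℝ φ) s volume :=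
        eLpNorm_le_eLpNorm_fderiv_of_le volume (hφ.of_le (by simp)) hsub hs1
          (by simpa using hsd) (by simpa using hs4) hb
    _ = A * eLpNorm (fderiv ℝ φ) s (volume.restrict Ω) := by
        rw [eLpNorm_restrict_eq_of_forall_notMem fun x hx =>
          Function.notMem_support.1 fun h => hx (hsub' h)]
    _ ≤ A * eLpNorm (classicalGrad φ) s (volume.restrict Ω) := by
        gcongr
        exact eLpNorm_mono (norm_fderiv_le_norm_classicalGrad φ)
    _ ≤ A * (eLpNorm (classicalGrad φ) 2 (volume.restrict Ω) * B) := by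
        gcongr
        exact eLpNorm_le_eLpNorm_mul_rpow_measure_univ (by exact_mod_cast hs2)
          hg.aestronglyMeasurable
    _ = _ := by
        rw [ENNReal.coe_mul, ENNReal.coe_toNNReal hB]
        ring

/-- Fatou along an almost everywhere convergent subsequence: a bound in one exponent `q` survives
convergence in another exponent `p`. -/
theorem eLpNorm_le_of_tendsto_Lp {α F : Type*} [MeasurableSpace α] {μ : Measure α}
    [NormedAddCommGroup F] {p q : ℝ≥0∞} [Fact (1 ≤ p)] {f : ℕ → Lp F p μ} {g : Lp F p μ}
    (hf : Tendsto f atTop (𝓝 g)) {a : ℕ → ℝ≥0∞} {b : ℝ≥0∞} (ha : Tendsto a atTop (𝓝 b))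
    (hfa : ∀ n, eLpNorm (f n) q μ ≤ a n) : eLpNorm g q μ ≤ b := by
  obtain ⟨ns, hns, hlim⟩ := (tendstoInMeasure_of_tendsto_Lp hf).exists_seq_tendsto_ae
  calc eLpNorm g q μ ≤ liminf (fun n => eLpNorm (f (ns n)) q μ) atTop :=
        Lp.eLpNorm_lim_le_liminf_eLpNorm (fun n => Lp.aestronglyMeasurable _) _ hlim
    _ ≤ liminf (fun n => a (ns n)) atTop := liminf_le_liminf (.of_forall fun n => hfa _)
    _ = b := (ha.comp hns.tendsto_atTop).liminf_eq

/-- The Sobolev inequality `‖u‖_{L⁴} ≤ C ‖∇u‖_{L²}` on `H¹₀(Ω)`. -/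
theorem exists_eLpNorm_four_le (hd : d = 2 ∨ d = 3) (hb : Bornology.IsBounded Ω) :
    ∃ C : ℝ≥0, ∀ u : H10 Ω, eLpNorm (vel u) 4 (volume.restrict Ω) ≤ C * ‖grad u‖ₑ := by
  obtain ⟨C, hC⟩ := exists_eLpNorm_four_le_of_testPairs hd hb
  refine ⟨C, fun u => ?_⟩
  have hu : u.1 ∈ closure (Submodule.span ℝ (testPairs Ω) : Set (L2Vec Ω × L2Mat Ω)) := u.2
  obtain ⟨p, hp, hlim⟩ := mem_closure_iff_seq_limit.1 hu
  have h1 : Tendsto (fun n => (p n).1) atTop (𝓝 u.1.1) := (continuous_fst.tendsto _).comp hlim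
  have h2 : Tendsto (fun n => (p n).2) atTop (𝓝 u.1.2) := (continuous_snd.tendsto _).comp hlim
  have h3 : Tendsto (fun n => (C : ℝ≥0∞) * ‖(p n).2‖ₑ) atTop (𝓝 (C * ‖u.1.2‖ₑ)) :=
    ENNReal.Tendsto.const_mul ((continuous_enorm.tendsto _).comp h2) (Or.inr ENNReal.coe_ne_top)
  refine eLpNorm_le_of_tendsto_Lp h1 h3 fun n => ?_
  have := hC _ (mem_testPairs_of_mem_span (hp n))
  rwa [← Lp.enorm_def] at this

/-! ### Boundedness and trilinearity of `b*` -/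

theorem vel_add (u v : H10 Ω) : vel (u + v) =ᵐ[volume.restrict Ω] vel u + vel v :=
  Lp.coeFn_add _ _

theorem vel_smul (c : ℝ) (u : H10 Ω) : vel (c • u) =ᵐ[volume.restrict Ω] c • vel u :=
  Lp.coeFn_smul _ _

theorem grad_add (u v : H10 Ω) : grad (u + v) = grad u + grad v := rfl

theorem grad_smul (c : ℝ) (u : H10 Ω) : grad (c • u) = c • grad u := rfl

theorem grad_add_ae (u v : H10 Ω) :
    (grad (u + v) : E d → Mat d) =ᵐ[volume.restrict Ω] grad u + grad v :=
  Lp.coeFn_add _ _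

theorem grad_smul_ae (c : ℝ) (u : H10 Ω) :
    (grad (c • u) : E d → Mat d) =ᵐ[volume.restrict Ω] c • (grad u : E d → Mat d) :=
  Lp.coeFn_smul _ _

/-- The integrand `∑_{i,j} a_j G_{ij} b_i` of the convection form. -/
def convInt (a : E d) (G : Mat d) (b : E d) : ℝ := ∑ i, ∑ j, a j * G (i, j) * b i

theorem norm_convInt_le (a : E d) (G : Mat d) (b : E d) :
    ‖convInt a G b‖ ≤ (d * d : ℝ≥0) * ‖‖a‖ * ‖b‖ * ‖G‖‖ := by
  have h : ∀ i j, ‖a j * G (i, j) * b i‖ ≤ ‖a‖ * ‖b‖ * ‖G‖ := fun i j => by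
    rw [norm_mul, norm_mul, mul_right_comm]
    gcongr
    exacts [PiLp.norm_apply_le a j, PiLp.norm_apply_le b i, PiLp.norm_apply_le G (i, j)]
  calc ‖convInt a G b‖ ≤ ∑ i : Fin d, ∑ j : Fin d, ‖a‖ * ‖b‖ * ‖G‖ :=
        norm_sum_le_of_le _ fun i _ => norm_sum_le_of_le _ fun j _ => h i j
    _ = _ := by
        rw [Real.norm_of_nonneg (by positivity : 0 ≤ ‖a‖ * ‖b‖ * ‖G‖)]
        simp [mul_assoc]

theorem aestronglyMeasurable_convInt {μ : Measure (E d)} {a b : E d → E d} {G : E d → Mat d}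
    (ha : AEStronglyMeasurable a μ) (hG : AEStronglyMeasurable G μ)
    (hb : AEStronglyMeasurable b μ) :
    AEStronglyMeasurable (fun x => convInt (a x) (G x) (b x)) μ := by
  have hc : Continuous fun p : E d × Mat d × E d => convInt p.1 p.2.1 p.2.2 := by
    refine continuous_finsetSum _ fun i _ => continuous_finsetSum _ fun j _ => ?_
    have h1 (k : Fin d) : Continuous fun a : E d => a k := (EuclideanSpace.proj k).continuous
    have h2 (k : Fin d × Fin d) : Continuous fun A : Mat d => A k :=
      (EuclideanSpace.proj k).continuous
    exact (((h1 j).comp continuous_fst).mul ((h2 (i, j)).comp (continuous_fst.comp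
      continuous_snd))).mul ((h1 i).comp (continuous_snd.comp continuous_snd))
  have h := hc.comp_aestronglyMeasurable (ha.prodMk (hG.prodMk hb))
  exact h

instance holderTriple_four_four_two : ENNReal.HolderTriple 4 4 2 where
  inv_add_inv_eq_inv := by
    rw [← two_mul, show (4 : ℝ≥0∞) = 2 * 2 by norm_num,
      ENNReal.mul_inv (Or.inl (by norm_num)) (Or.inl (by norm_num)), ← mul_assoc,
      ENNReal.mul_inv_cancel (by norm_num) (by norm_num), one_mul]

/-- Hölder twice: `1/4 + 1/4 = 1/2`, then `1/2 + 1/2 = 1`. -/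
theorem eLpNorm_convInt_le {μ : Measure (E d)} {a b : E d → E d} {G : E d → Mat d}
    (ha : AEStronglyMeasurable a μ) (hG : AEStronglyMeasurable G μ)
    (hb : AEStronglyMeasurable b μ) :
    eLpNorm (fun x => convInt (a x) (G x) (b x)) 1 μ ≤
      (d * d : ℝ≥0) * (eLpNorm a 4 μ * eLpNorm b 4 μ * eLpNorm G 2 μ) := by
  have h1 : eLpNorm (fun x => ‖a x‖ * ‖b x‖) 2 μ ≤ eLpNorm a 4 μ * eLpNorm b 4 μ := by
    simpa using! eLpNorm_le_eLpNorm_mul_eLpNorm'_of_norm (r := 2) (p := 4) (q := 4) ha hb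
      (fun y z => ‖y‖ * ‖z‖) 1 (.of_forall fun x => by simp)
  have h2 : eLpNorm (fun x => ‖a x‖ * ‖b x‖ * ‖G x‖) 1 μ ≤
      eLpNorm (fun x => ‖a x‖ * ‖b x‖) 2 μ * eLpNorm G 2 μ := by
    simpa using! eLpNorm_le_eLpNorm_mul_eLpNorm'_of_norm (r := 1) (p := 2) (q := 2)
      (ha.norm.mul hb.norm) hG (fun (y : ℝ) z => y * ‖z‖) 1 (.of_forall fun x => by simp)
  calc eLpNorm (fun x => convInt (a x) (G x) (b x)) 1 μ ≤
      (d * d : ℝ≥0) * eLpNorm (fun x => ‖a x‖ * ‖b x‖ * ‖G x‖) 1 μ :=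
        eLpNorm_le_nnreal_smul_eLpNorm_of_ae_le_mul
          (.of_forall fun x => norm_convInt_le (a x) (G x) (b x)) 1
    _ ≤ _ := by gcongr; exact h2.trans (by gcongr)

theorem convection_eq (u v w : H10 Ω) :
    convection u v w = ∫ x in Ω, convInt (vel u x) (grad v x) (vel w x) := rfl

theorem aestronglyMeasurable_convInt_vel (u v w : H10 Ω) :
    AEStronglyMeasurable (fun x => convInt (vel u x) (grad v x) (vel w x))
      (volume.restrict Ω) :=
  aestronglyMeasurable_convInt (Lp.aestronglyMeasurable _) (Lp.aestronglyMeasurable _)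
    (Lp.aestronglyMeasurable _)

/-- The trilinear integrand is controlled by the gradients. -/
theorem exists_eLpNorm_convInt_le (hd : d = 2 ∨ d = 3) (hb : Bornology.IsBounded Ω) :
    ∃ C : ℝ≥0, ∀ u v w : H10 Ω,
      eLpNorm (fun x => convInt (vel u x) (grad v x) (vel w x)) 1 (volume.restrict Ω) ≤
        C * (‖grad u‖ₑ * ‖grad v‖ₑ * ‖grad w‖ₑ) := by
  obtain ⟨S, hS⟩ := exists_eLpNorm_four_le hd hb
  refine ⟨d * d * S * S, fun u v w => ?_⟩
  calc _ ≤ (d * d : ℝ≥0) * (eLpNorm (vel u) 4 (volume.restrict Ω) *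
        eLpNorm (vel w) 4 (volume.restrict Ω) * eLpNorm (grad v) 2 (volume.restrict Ω)) :=
        eLpNorm_convInt_le (Lp.aestronglyMeasurable _) (Lp.aestronglyMeasurable _)
          (Lp.aestronglyMeasurable _)
    _ ≤ (d * d : ℝ≥0) * ((S * ‖grad u‖ₑ) * (S * ‖grad w‖ₑ) * ‖grad v‖ₑ) := by
        rw [Lp.enorm_def (grad v)]
        gcongr
        exacts [hS u, hS w]
    _ = _ := by push_cast; ring

theorem integrable_convInt (hd : d = 2 ∨ d = 3) (hb : Bornology.IsBounded Ω) (u v w : H10 Ω) :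
    Integrable (fun x => convInt (vel u x) (grad v x) (vel w x)) (volume.restrict Ω) := by
  obtain ⟨C, hC⟩ := exists_eLpNorm_convInt_le hd hb
  rw [← memLp_one_iff_integrable]
  refine ⟨aestronglyMeasurable_convInt_vel u v w, (hC u v w).trans_lt ?_⟩
  exact ENNReal.mul_lt_top ENNReal.coe_lt_top
    (ENNReal.mul_lt_top (ENNReal.mul_lt_top enorm_lt_top enorm_lt_top) enorm_lt_top)

theorem exists_abs_convection_le (hd : d = 2 ∨ d = 3) (hb : Bornology.IsBounded Ω) :
    ∃ C : ℝ≥0, ∀ u v w : H10 Ω,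
      |convection u v w| ≤ C * (‖grad u‖ * ‖grad v‖ * ‖grad w‖) := by
  obtain ⟨C, hC⟩ := exists_eLpNorm_convInt_le hd hb
  refine ⟨C, fun u v w => ?_⟩
  have h : ‖convection u v w‖ₑ ≤ C * (‖grad u‖ₑ * ‖grad v‖ₑ * ‖grad w‖ₑ) := by
    rw [convection_eq]
    refine (enorm_integral_le_lintegral_enorm _).trans ?_
    rw [← eLpNorm_one_eq_lintegral_enorm]
    exact hC u v w
  have h' : ‖convection u v w‖₊ ≤ C * (‖grad u‖₊ * ‖grad v‖₊ * ‖grad w‖₊) := by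
    simp only [enorm_eq_nnnorm] at h
    exact_mod_cast h
  exact_mod_cast h'

/-- Some `M > 0` bounds `b*` on `H¹₀(Ω)`. -/
theorem exists_isBStarBound (hd : d = 2 ∨ d = 3) (hb : Bornology.IsBounded Ω) :
    ∃ M : ℝ, 0 < M ∧ IsBStarBound Ω M := by
  obtain ⟨C, hC⟩ := exists_abs_convection_le hd hb
  -- `C` may vanish; adding one makes the bound positive.
  refine ⟨C + 1, by positivity, fun u v w => ?_⟩
  have h1 := hC u v w
  have h2 := hC u w v
  have h3 : 0 ≤ ‖grad u‖ * ‖grad v‖ * ‖grad w‖ := by positivity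
  rw [mul_right_comm] at h2
  rw [abs_le] at *
  unfold bStar
  constructor <;> nlinarith

theorem exists_convection_eq_linearMap (hd : d = 2 ∨ d = 3) (hb : Bornology.IsBounded Ω) :
    ∃ B : H10 Ω →ₗ[ℝ] H10 Ω →ₗ[ℝ] H10 Ω →ₗ[ℝ] ℝ, ∀ u v w, B u v w = convection u v w := by
  -- Additivity of the Bochner integral requires integrable summands.
  have hi := integrable_convInt hd hb
  have add1 (u u' v w : H10 Ω) :
      convection (u + u') v w = convection u v w + convection u' v w := by
    simp only [convection_eq]
    rw [← integral_add (hi u v w) (hi u' v w)]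
    refine integral_congr_ae ?_
    filter_upwards [vel_add u u'] with x hx
    simp [convInt, hx, add_mul, Finset.sum_add_distrib]
  have add2 (u v v' w : H10 Ω) :
      convection u (v + v') w = convection u v w + convection u v' w := by
    simp only [convection_eq]
    rw [← integral_add (hi u v w) (hi u v' w)]
    refine integral_congr_ae ?_
    filter_upwards [grad_add_ae v v'] with x hx
    simp [convInt, hx, add_mul, mul_add, Finset.sum_add_distrib]
  have add3 (u v w w' : H10 Ω) :
      convection u v (w + w') = convection u v w + convection u v w' := by
    simp only [convection_eq]
    rw [← integral_add (hi u v w) (hi u v w')]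
    refine integral_congr_ae ?_
    filter_upwards [vel_add w w'] with x hx
    simp [convInt, hx, mul_add, Finset.sum_add_distrib]
  have smul1 (c : ℝ) (u v w : H10 Ω) : convection (c • u) v w = c * convection u v w := by
    simp only [convection_eq]
    rw [← integral_const_mul]
    refine integral_congr_ae ?_
    filter_upwards [vel_smul c u] with x hx
    simp [convInt, hx, mul_assoc, Finset.mul_sum]
  have smul2 (c : ℝ) (u v w : H10 Ω) : convection u (c • v) w = c * convection u v w := by
    simp only [convection_eq]
    rw [← integral_const_mul]
    refine integral_congr_ae ?_
    filter_upwards [grad_smul_ae c v] with x hx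
    simp [convInt, hx, mul_assoc, mul_left_comm, Finset.mul_sum]
  have smul3 (c : ℝ) (u v w : H10 Ω) : convection u v (c • w) = c * convection u v w := by
    simp only [convection_eq]
    rw [← integral_const_mul]
    refine integral_congr_ae ?_
    filter_upwards [vel_smul c w] with x hx
    simp [convInt, hx, mul_left_comm, Finset.mul_sum]
  refine ⟨LinearMap.mk₂ ℝ (fun u v =>
    { toFun := convection u v, map_add' := add3 u v, map_smul' := fun c => smul3 c u v })
    ?_ ?_ ?_ ?_, fun u v w => rfl⟩
  · exact fun u u' v => LinearMap.ext (add1 u u' v)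
  · exact fun c u v => LinearMap.ext (smul1 c u v)
  · exact fun u v v' => LinearMap.ext (add2 u v v')
  · exact fun c u v => LinearMap.ext (smul2 c u v)

/-- `b*` is trilinear on `H¹₀(Ω)`. -/
theorem exists_bStar_eq_linearMap (hd : d = 2 ∨ d = 3) (hb : Bornology.IsBounded Ω) :
    ∃ B : H10 Ω →ₗ[ℝ] H10 Ω →ₗ[ℝ] H10 Ω →ₗ[ℝ] ℝ, ∀ u v w, B u v w = bStar u v w := by
  obtain ⟨B, hB⟩ := exists_convection_eq_linearMap hd hb
  refine ⟨LinearMap.mk₂ ℝ (fun u v => (1 / 2 : ℝ) • B u v - (1 / 2 : ℝ) • (B u).flip v)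
    ?_ ?_ ?_ ?_, fun u v w => by simp [bStar, hB]⟩
  all_goals
    intros
    ext
    simp
    ring

theorem bStar_self (u v : H10 Ω) : bStar u v v = 0 := sub_self _

/-! ### Poincaré inequality and dual norm -/

/-- The Poincaré inequality on `H¹₀(Ω)`, in the product norm of `(u, ∇u)`. -/
theorem exists_norm_le_norm_grad (hd : d = 2 ∨ d = 3) (hb : Bornology.IsBounded Ω) :
    ∃ C : ℝ≥0, ∀ u : H10 Ω, ‖u‖ ≤ C * ‖grad u‖ := by
  have := isFiniteMeasure_restrict hb
  obtain ⟨S, hS⟩ := exists_eLpNorm_four_le hd hb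
  let A : ℝ≥0∞ := (volume.restrict Ω) Set.univ ^
    (1 / (2 : ℝ≥0∞).toReal - 1 / (4 : ℝ≥0∞).toReal)
  have hA : A ≠ ∞ := ENNReal.rpow_ne_top_of_nonneg (by norm_num) (measure_ne_top _ _)
  refine ⟨max (S * A.toNNReal) 1, fun u => ?_⟩
  have h : ‖u.1.1‖ₑ ≤ (S * A.toNNReal : ℝ≥0) * ‖grad u‖ₑ := by
    calc ‖u.1.1‖ₑ = eLpNorm (vel u) 2 (volume.restrict Ω) := Lp.enorm_def _
      _ ≤ eLpNorm (vel u) 4 (volume.restrict Ω) * A :=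
          eLpNorm_le_eLpNorm_mul_rpow_measure_univ (by norm_num) (Lp.aestronglyMeasurable _)
      _ ≤ S * ‖grad u‖ₑ * A := by gcongr; exact hS u
      _ = _ := by rw [ENNReal.coe_mul, ENNReal.coe_toNNReal hA]; ring
  have h' : ‖u.1.1‖ ≤ (S * A.toNNReal : ℝ≥0) * ‖grad u‖ := by
    simp only [enorm_eq_nnnorm] at h
    exact_mod_cast h
  have hn := norm_nonneg (grad u)
  refine max_le (h'.trans ?_) ?_
  · gcongr
    exact le_max_left _ _
  · calc ‖u.1.2‖ = 1 * ‖grad u‖ := (one_mul _).symm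
      _ ≤ _ := by
        gcongr
        exact_mod_cast le_max_right (S * A.toNNReal) 1

theorem dualNorm_nonneg (f : H10 Ω →L[ℝ] ℝ) : 0 ≤ dualNorm f :=
  Real.iSup_nonneg fun v => by positivity

/-- `⟨f, v⟩ ≤ ‖f‖_{-1} ‖∇v‖`. -/
theorem le_dualNorm_mul (hd : d = 2 ∨ d = 3) (hb : Bornology.IsBounded Ω) (f : H10 Ω →L[ℝ] ℝ)
    (v : H10 Ω) : f v ≤ dualNorm f * ‖grad v‖ := by
  obtain ⟨C, hC⟩ := exists_norm_le_norm_grad hd hb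
  -- Poincaré makes the supremum genuine; a real supremum of an unbounded family would default to
  -- `0`.
  have hbd : BddAbove (Set.range fun v : H10 Ω => |f v| / ‖grad v‖) := by
    refine ⟨‖f‖ * C, ?_⟩
    rintro _ ⟨v, rfl⟩
    refine div_le_of_le_mul₀ (norm_nonneg _) (by positivity) ?_
    calc |f v| ≤ ‖f‖ * ‖v‖ := f.le_opNorm v
      _ ≤ ‖f‖ * (C * ‖grad v‖) := by gcongr; exact hC v
      _ = _ := by ring
  -- If `∇v = 0` the quotient is the default `0` and says nothing, but then `v = 0` by Poincaré.
  rcases (norm_nonneg (grad v)).eq_or_lt with h | h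
  · have hv : ‖v‖ ≤ 0 := by simpa [← h] using hC v
    rw [norm_le_zero_iff.1 hv, map_zero]
    exact mul_nonneg (dualNorm_nonneg f) (norm_nonneg _)
  · refine (le_abs_self _).trans ?_
    rw [← div_le_iff₀ h]
    exact le_ciSup hbd v

/-! ### The discretely divergence free subspace -/

theorem integrable_divPairing (v : H10 Ω) (q : L2Scal Ω) :
    Integrable (fun x => (∑ i, grad v x (i, i)) * q x) (volume.restrict Ω) := by
  refine MemLp.integrable_mul (p := 2) (q := 2) (memLp_finsetSum _ fun i _ => ?_) (Lp.memLp q)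
  exact (EuclideanSpace.proj (i, i) : Mat d →L[ℝ] ℝ).comp_memLp' (Lp.memLp (grad v))

theorem divPairing_add (v w : H10 Ω) (q : L2Scal Ω) :
    divPairing (v + w) q = divPairing v q + divPairing w q := by
  unfold divPairing
  rw [← integral_add (integrable_divPairing v q) (integrable_divPairing w q)]
  refine integral_congr_ae ?_
  filter_upwards [grad_add_ae v w] with x hx
  simp [hx, Finset.sum_add_distrib, add_mul]

theorem divPairing_smul (c : ℝ) (v : H10 Ω) (q : L2Scal Ω) :
    divPairing (c • v) q = c * divPairing v q := by
  unfold divPairing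
  rw [← integral_const_mul]
  refine integral_congr_ae ?_
  filter_upwards [grad_smul_ae c v] with x hx
  simp [hx, ← Finset.mul_sum, mul_assoc]

/-- `V_h` as a subspace of `X`. -/
def discDivFreeSubmodule (Xh : Submodule ℝ (H10 Ω)) (Qh : Submodule ℝ (L2Scal Ω)) :
    Submodule ℝ (H10 Ω) where
  carrier := discDivFree Xh Qh
  add_mem' := fun hv hw => ⟨Xh.add_mem hv.1 hw.1, fun q hq => by
    rw [divPairing_add, hv.2 q hq, hw.2 q hq, add_zero]⟩
  zero_mem' := ⟨Xh.zero_mem, fun q _ => by simpa using divPairing_smul 0 (0 : H10 Ω) q⟩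
  smul_mem' := fun c v hv => ⟨Xh.smul_mem c hv.1, fun q hq => by
    rw [divPairing_smul, hv.2 q hq, mul_zero]⟩

/-! ### Estimates for the Picard operator -/

theorem grad_sub (u v : H10 Ω) : grad (u - v) = grad u - grad v := rfl

theorem inner_grad_self (u : H10 Ω) : inner ℝ (grad u) (grad u) = ‖grad u‖ ^ 2 :=
  real_inner_self_eq_norm_sq _

theorem mul_le_of_mul_sq_le_mul {ν a b : ℝ} (ha : 0 ≤ a) (hb : 0 ≤ b)
    (h : ν * a ^ 2 ≤ b * a) : ν * a ≤ b := by
  rcases ha.eq_or_lt with rfl | ha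
  · simpa using hb
  · exact le_of_mul_le_mul_right (by linarith) ha

/-- Stability of the Picard operator: `‖∇G(w)‖ ≤ ν⁻¹ ‖f‖_{-1}`. -/
theorem IsPicardSolution.norm_grad_le (hd : d = 2 ∨ d = 3) (hb : Bornology.IsBounded Ω)
    {ν : ℝ} {f : H10 Ω →L[ℝ] ℝ} {V : Set (H10 Ω)} {w g : H10 Ω}
    (h : IsPicardSolution ν f V w g) : ν * ‖grad g‖ ≤ dualNorm f := by
  refine mul_le_of_mul_sq_le_mul (norm_nonneg _) (dualNorm_nonneg f) ?_
  have h1 := h.2 g h.1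
  rw [bStar_self, inner_grad_self, zero_add] at h1
  rw [h1]
  exact le_dualNorm_mul hd hb f g

theorem picard_const_mul_le {M ν κ D x y : ℝ} (hM : 0 < M) (hν : 0 < ν)
    (hκ : κ = M * (ν ^ 2)⁻¹ * D) (hx : 0 ≤ x) (hy : ν * y ≤ D) :
    M * x * y ≤ ν * (κ * x) := by
  have : ν * (κ * x) = M * x * (D / ν) := by
    rw [hκ]
    field_simp
  rw [this]
  gcongr
  rw [le_div_iff₀ hν]
  linarith

/-- The Picard operator is a contraction with factor `κ` in the gradient norm. -/
theorem IsPicardSolution.norm_grad_sub_le (hd : d = 2 ∨ d = 3) (hb : Bornology.IsBounded Ω)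
    {M ν κ : ℝ} (hM : 0 < M) (hν : 0 < ν) (hbound : IsBStarBound Ω M) {f : H10 Ω →L[ℝ] ℝ}
    (hκ : κ = M * (ν ^ 2)⁻¹ * dualNorm f) {V : Submodule ℝ (H10 Ω)} {w w' g g' : H10 Ω}
    (h : IsPicardSolution ν f V w g) (h' : IsPicardSolution ν f V w' g') :
    ‖grad (g - g')‖ ≤ κ * ‖grad (w - w')‖ := by
  have hκ0 : 0 ≤ κ := by
    rw [hκ]
    exact mul_nonneg (by positivity) (dualNorm_nonneg f)
  obtain ⟨B, hB⟩ := exists_bStar_eq_linearMap hd hb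
  have hz : g - g' ∈ V := V.sub_mem h.1 h'.1
  have e1 := h.2 _ hz
  have e2 := h'.2 _ hz
  have e3 := bStar_self w (g - g')
  have e4 := hbound (w - w') g' (g - g')
  have e5 := inner_grad_self (g - g')
  have hG := h'.norm_grad_le hd hb
  refine le_of_mul_le_mul_left (mul_le_of_mul_sq_le_mul
    (norm_nonneg (grad (g - g'))) (by positivity) ?_) hν
  have e6 : M * ‖grad (w - w')‖ * ‖grad g'‖ * ‖grad (g - g')‖ ≤
      ν * (κ * ‖grad (w - w')‖) * ‖grad (g - g')‖ := by
    exact mul_le_mul_of_nonneg_right (picard_const_mul_le hM hν hκ (norm_nonneg _) hG)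
      (norm_nonneg _)
  refine le_trans ?_ e6
  -- With `z = g - g'`, subtracting the two equations leaves `ν ‖∇z‖² = -b*(w - w', g', z)`, because
  -- `b*(w, z, z) = 0`.
  refine le_trans (le_of_eq ?_) ((neg_le_abs _).trans e4)
  rw [← e5]
  rw [grad_sub g g', inner_sub_left, mul_sub, ← grad_sub g g']
  rw [← hB] at e1 e2 e3 ⊢
  simp only [map_sub, LinearMap.sub_apply] at e1 e2 e3 ⊢
  linarith

/-- One step of an affine combination of three Picard updates: the residual of the combination is
controlled by the combination of the residuals, up to products of differences. -/
theorem norm_grad_residual_le (hd : d = 2 ∨ d = 3) (hb : Bornology.IsBounded Ω)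
    {M ν κ : ℝ} (hM : 0 < M) (hν : 0 < ν) (hbound : IsBStarBound Ω M) {f : H10 Ω →L[ℝ] ℝ}
    (hκ : κ = M * (ν ^ 2)⁻¹ * dualNorm f) {V : Submodule ℝ (H10 Ω)}
    {u₀ u₁ u₂ g₀ g₁ g₂ g : H10 Ω} {a₀ a₁ a₂ : ℝ} (ha : a₀ + a₁ + a₂ = 1)
    (h₀ : IsPicardSolution ν f V u₀ g₀) (h₁ : IsPicardSolution ν f V u₁ g₁)
    (h₂ : IsPicardSolution ν f V u₂ g₂)
    (h : IsPicardSolution ν f V (a₀ • g₀ + a₁ • g₁ + a₂ • g₂) g) :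
    ‖grad (g - (a₀ • g₀ + a₁ • g₁ + a₂ • g₂))‖ ≤
      κ * ‖grad (a₀ • (g₀ - u₀) + a₁ • (g₁ - u₁) + a₂ • (g₂ - u₂))‖ +
        M / ν * (|a₀| * |a₁| * (‖grad (u₀ - u₁)‖ * ‖grad (g₀ - g₁)‖) +
          |a₀| * |a₂| * (‖grad (u₀ - u₂)‖ * ‖grad (g₀ - g₂)‖) +
          |a₁| * |a₂| * (‖grad (u₁ - u₂)‖ * ‖grad (g₁ - g₂)‖)) := by
  have hκ0 : 0 ≤ κ := by
    rw [hκ]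
    exact mul_nonneg (by positivity) (dualNorm_nonneg f)
  obtain ⟨B, hB⟩ := exists_bStar_eq_linearMap hd hb
  have hU : a₀ • g₀ + a₁ • g₁ + a₂ • g₂ ∈ V :=
    V.add_mem (V.add_mem (V.smul_mem _ h₀.1) (V.smul_mem _ h₁.1)) (V.smul_mem _ h₂.1)
  have hz := V.sub_mem h.1 hU
  have hG := h.norm_grad_le hd hb
  obtain ⟨U, hUdef⟩ : ∃ U, U = a₀ • g₀ + a₁ • g₁ + a₂ • g₂ := ⟨_, rfl⟩
  obtain ⟨z, hzdef⟩ : ∃ z, z = g - U := ⟨_, rfl⟩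
  obtain ⟨W, hW⟩ : ∃ W, W = a₀ • (g₀ - u₀) + a₁ • (g₁ - u₁) + a₂ • (g₂ - u₂) := ⟨_, rfl⟩
  rw [← hUdef] at h
  rw [← hUdef, ← hzdef] at hz
  rw [← hUdef, ← hW, ← hzdef]
  have e₀ := h₀.2 z hz
  have e₁ := h₁.2 z hz
  have e₂ := h₂.2 z hz
  have e := h.2 z hz
  have es := bStar_self (U - W) z
  have key : ν * ‖grad z‖ ^ 2 = -bStar W g z + a₀ * a₁ * bStar (u₀ - u₁) (g₀ - g₁) z +
      a₀ * a₂ * bStar (u₀ - u₂) (g₀ - g₂) z + a₁ * a₂ * bStar (u₁ - u₂) (g₁ - g₂) z := by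
    have hI (x : L2Mat Ω) : inner ℝ (grad z) x = inner ℝ (grad g) x -
        (a₀ * inner ℝ (grad g₀) x + a₁ * inner ℝ (grad g₁) x + a₂ * inner ℝ (grad g₂) x) := by
      have : grad z = grad g - (a₀ • grad g₀ + a₁ • grad g₁ + a₂ • grad g₂) := by
        rw [hzdef, hUdef]
        rfl
      rw [this]
      simp only [inner_sub_left, inner_add_left, real_inner_smul_left]
    -- Skew-symmetry replaces `g` by `U`, so that both arguments become averages with the weights
    -- `a_j`.
    have hes : B (U - W) g z = B (U - W) U z := by
      rw [← hB, show B (U - W) z = B (U - W) g - B (U - W) U by rw [hzdef, map_sub],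
        LinearMap.sub_apply] at es
      linarith
    rw [← inner_grad_self, hI]
    simp only [← hB] at e₀ e₁ e₂ e ⊢
    have hUW : U - W = a₀ • u₀ + a₁ • u₁ + a₂ • u₂ := by
      rw [hUdef, hW]
      module
    have hBU : B U g z = B (U - W) U z + B W g z := by
      rw [← hes, map_sub]
      simp
    rw [hBU] at e
    rw [hUW, hUdef] at e
    simp only [map_add, map_sub, map_smul, LinearMap.add_apply, LinearMap.sub_apply,
      LinearMap.smul_apply, smul_eq_mul] at e ⊢
    -- The covariance identity holds only for weights of sum one; eliminating `a₂` makes it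
    -- polynomial.
    obtain rfl : a₂ = 1 - a₀ - a₁ := by linarith
    linear_combination e - a₀ * e₀ - a₁ * e₁ - (1 - a₀ - a₁) * e₂
  have t : ∀ (a b : ℝ) (x y : H10 Ω),
      a * b * bStar x y z ≤ M * (|a| * |b| * (‖grad x‖ * ‖grad y‖)) * ‖grad z‖ := by
    intro a b x y
    calc a * b * bStar x y z ≤ |a| * |b| * |bStar x y z| := by
          rw [← abs_mul, ← abs_mul]
          exact le_abs_self _
      _ ≤ |a| * |b| * (M * ‖grad x‖ * ‖grad y‖ * ‖grad z‖) := by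
          gcongr
          exact hbound x y z
      _ = _ := by ring
  have t0 : -bStar W g z ≤ ν * (κ * ‖grad W‖) * ‖grad z‖ := by
    refine ((neg_le_abs _).trans (hbound W g z)).trans ?_
    exact mul_le_mul_of_nonneg_right (picard_const_mul_le hM hν hκ (norm_nonneg _) hG)
      (norm_nonneg _)
  refine le_of_mul_le_mul_left (mul_le_of_mul_sq_le_mul
    (norm_nonneg (grad z)) (by positivity) ?_) hν
  rw [key, mul_add, ← mul_assoc ν (M / ν), mul_div_cancel₀ _ hν.ne']
  have t1 := t a₀ a₁ (u₀ - u₁) (g₀ - g₁)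
  have t2 := t a₀ a₂ (u₀ - u₂) (g₀ - g₂)
  have t3 := t a₁ a₂ (u₁ - u₂) (g₁ - g₂)
  linarith

/-- Differences of arguments are controlled by the Picard residuals. -/
theorem norm_grad_sub_le_of_contraction {κ r : ℝ} (hκ : κ < 1) {u u' g g' : H10 Ω}
    (h : ‖grad (g - g')‖ ≤ κ * ‖grad (u - u')‖) (hr : ‖grad (g - u)‖ ≤ r)
    (hr' : ‖grad (g' - u')‖ ≤ r) : ‖grad (u - u')‖ ≤ 2 * r / (1 - κ) := by
  have h1 : grad (u - u') = grad (g - g') - grad (g - u) + grad (g' - u') := by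
    simp only [grad_sub]
    abel
  have h2 : ‖grad (u - u')‖ ≤ ‖grad (g - g')‖ + ‖grad (g - u)‖ + ‖grad (g' - u')‖ := by
    conv_lhs => rw [h1]
    exact (norm_add_le _ _).trans (by gcongr; exact norm_sub_le _ _)
  rw [le_div_iff₀ (by linarith)]
  linarith

/-! ### The optimization step and its gain -/

theorem sum_window_two {A : Type*} [AddCommMonoid A] (n : ℕ) (F : ℕ → A) :
    ∑ j ∈ window 2 (n + 2), F j = F n + F (n + 1) + F (n + 2) := by
  have : window 2 (n + 2) = Finset.Icc n (n + 2) := by simp [window]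
  rw [this, Finset.sum_Icc_succ_top (by omega), Finset.sum_Icc_succ_top (by omega),
    Finset.Icc_self, Finset.sum_singleton]

section Gain

variable {m k : ℕ} {ν : ℝ} {f : H10 Ω →L[ℝ] ℝ} {V : Set (H10 Ω)} {u ut : ℕ → H10 Ω}
  {α : ℕ → ℕ → ℝ}

/-- The unit weight at `j` is an admissible competitor. -/
theorem IsAndersonPicard.norm_grad_sum_le (h : IsAndersonPicard m ν f V u ut α) {j : ℕ}
    (hj : j ∈ window m k) :
    ‖grad (∑ i ∈ window m k, α (k + 1) i • (ut (i + 1) - u i))‖ ≤ ‖grad (ut (j + 1) - u j)‖ := by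
  simpa [Pi.single_apply, ite_smul, hj] using h.optimal k (Pi.single j 1) (by simp [hj])

theorem IsAndersonPicard.isLeast (h : IsAndersonPicard m ν f V u ut α) (k : ℕ) :
    IsLeast {r : ℝ | ∃ a : ℕ → ℝ, ∑ j ∈ window m k, a j = 1 ∧
      r = ‖grad (∑ j ∈ window m k, a j • (ut (j + 1) - u j))‖}
      ‖grad (∑ j ∈ window m k, α (k + 1) j • (ut (j + 1) - u j))‖ := by
  refine ⟨⟨_, h.sum_one k, rfl⟩, ?_⟩
  rintro _ ⟨a, ha, rfl⟩
  exact h.optimal k a ha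

theorem IsAndersonPicard.exists_isGain (h : IsAndersonPicard m ν f V u ut α) (k : ℕ) :
    ∃ θ : ℝ, 0 ≤ θ ∧ θ ≤ 1 ∧ IsGain m u ut k θ := by
  have hk : k ∈ window m k := by simp [window]
  have hle := h.norm_grad_sum_le hk
  refine ⟨‖grad (∑ j ∈ window m k, α (k + 1) j • (ut (j + 1) - u j))‖ /
    ‖grad (ut (k + 1) - u k)‖, by positivity, div_le_one_of_le₀ hle (norm_nonneg _), ?_⟩
  unfold IsGain
  -- If `∇w_k = 0`, the minimum is also `0`, so the default value of the quotient is a valid gain.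
  rw [div_mul_cancel_of_imp fun h0 => le_antisymm (hle.trans h0.le) (norm_nonneg _)]
  exact h.isLeast k

theorem IsAndersonPicard.gain_mul_eq (h : IsAndersonPicard m ν f V u ut α) {θ : ℝ}
    (hθ : IsGain m u ut k θ) : θ * ‖grad (ut (k + 1) - u k)‖ =
      ‖grad (∑ j ∈ window m k, α (k + 1) j • (ut (j + 1) - u j))‖ :=
  hθ.unique (h.isLeast k)

end Gain

/-! ### The residual bound for depth two -/

/-- The constant of the quadratic remainder. -/
def remainderConst (M ν κ abar abreve : ℝ) : ℝ :=
  M / ν * (3 * abar ^ 2 * (2 * (1 + (1 + 2 * abar) / abreve) / (1 - κ)) ^ 2)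

/-- The residual bound for depth two, at step `n + 2`. -/
theorem IsAndersonPicard.norm_grad_residual_le (hd : d = 2 ∨ d = 3) (hb : Bornology.IsBounded Ω)
    {M ν κ abar abreve : ℝ} (hM : 0 < M) (hν : 0 < ν) (hκ1 : κ < 1) (habr : 0 < abreve)
    (hbound : IsBStarBound Ω M) {f : H10 Ω →L[ℝ] ℝ} (hκ : κ = M * (ν ^ 2)⁻¹ * dualNorm f)
    {V : Submodule ℝ (H10 Ω)} {u ut : ℕ → H10 Ω} {α : ℕ → ℕ → ℝ}
    (h : IsAndersonPicard 2 ν f V u ut α) {n : ℕ} (h0 : |α (n + 3) n| ≤ abar)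
    (h1 : |α (n + 3) (n + 1)| ≤ abar) (h2 : |α (n + 3) (n + 2)| ≤ abar)
    (h3 : abreve < |α (n + 3) (n + 2)|) {θ : ℝ} (hθ : IsGain 2 u ut (n + 2) θ) :
    ‖grad (ut (n + 4) - u (n + 3))‖ ≤ κ * θ * ‖grad (ut (n + 3) - u (n + 2))‖ +
      remainderConst M ν κ abar abreve *
        (max ‖grad (ut (n + 1) - u n)‖ ‖grad (ut (n + 2) - u (n + 1))‖) ^ 2 := by
  set m := max ‖grad (ut (n + 1) - u n)‖ ‖grad (ut (n + 2) - u (n + 1))‖ with hm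
  have hm0 : ‖grad (ut (n + 1) - u n)‖ ≤ m := le_max_left _ _
  have hm1 : ‖grad (ut (n + 2) - u (n + 1))‖ ≤ m := le_max_right _ _
  have hmn : 0 ≤ m := (norm_nonneg _).trans hm0
  have hab : 0 ≤ abar := (abs_nonneg _).trans h0
  have hκ0 : 0 ≤ κ := by
    rw [hκ]
    exact mul_nonneg (by positivity) (dualNorm_nonneg f)
  -- Comparing with the oldest residual, not with `w_k`, bounds the minimum by `m`.
  have hw := h.norm_grad_sum_le (k := n + 2) (j := n) (by simp [window])
  have hg := h.gain_mul_eq hθ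
  have hs := h.sum_one (n + 2)
  have hu := h.update (n + 2)
  rw [sum_window_two] at hw hg hs hu
  -- The quotient bounds `‖∇w_k‖ / m`; the extra `1` lets `S * m` dominate all three residuals.
  set S := 1 + (1 + 2 * abar) / abreve with hS
  have hS1 : 1 ≤ S := by
    have : 0 ≤ (1 + 2 * abar) / abreve := by positivity
    linarith
  have hk : ‖grad (ut (n + 3) - u (n + 2))‖ ≤ S * m := by
    have e1 : α (n + 3) (n + 2) • grad (ut (n + 3) - u (n + 2)) =
        grad (α (n + 3) n • (ut (n + 1) - u n) + α (n + 3) (n + 1) • (ut (n + 2) - u (n + 1)) +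
          α (n + 3) (n + 2) • (ut (n + 3) - u (n + 2))) -
        α (n + 3) n • grad (ut (n + 1) - u n) -
        α (n + 3) (n + 1) • grad (ut (n + 2) - u (n + 1)) := by
      simp only [grad_add, grad_smul]
      abel
    have e2 : |α (n + 3) (n + 2)| * ‖grad (ut (n + 3) - u (n + 2))‖ ≤
        m + abar * m + abar * m := by
      rw [← Real.norm_eq_abs, ← norm_smul, e1]
      refine (norm_sub_le _ _).trans (add_le_add ((norm_sub_le _ _).trans
        (add_le_add (hw.trans hm0) ?_)) ?_)
      · rw [norm_smul, Real.norm_eq_abs]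
        gcongr
      · rw [norm_smul, Real.norm_eq_abs]
        gcongr
    have e3 : ‖grad (ut (n + 3) - u (n + 2))‖ ≤ (1 + 2 * abar) / abreve * m := by
      rw [div_mul_eq_mul_div, le_div_iff₀ habr]
      nlinarith [norm_nonneg (grad (ut (n + 3) - u (n + 2)))]
    rw [hS, add_mul, one_mul]
    linarith
  have hmS : m ≤ S * m := le_mul_of_one_le_left hmn hS1
  have pair : ∀ {a b : ℝ} {i j : ℕ}, |a| ≤ abar → |b| ≤ abar →
      ‖grad (ut (i + 1) - u i)‖ ≤ S * m → ‖grad (ut (j + 1) - u j)‖ ≤ S * m →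
      |a| * |b| * (‖grad (u i - u j)‖ * ‖grad (ut (i + 1) - ut (j + 1))‖) ≤
        abar ^ 2 * (2 * S / (1 - κ)) ^ 2 * m ^ 2 := by
    intro a b i j ha hb' hi hj
    have hc := (h.picard i).norm_grad_sub_le hd hb hM hν hbound hκ (h.picard j)
    have hd' := norm_grad_sub_le_of_contraction hκ1 hc hi hj
    have hc' : ‖grad (ut (i + 1) - ut (j + 1))‖ ≤ 2 * (S * m) / (1 - κ) :=
      hc.trans ((mul_le_of_le_one_left (norm_nonneg _) hκ1.le).trans hd')
    calc _ ≤ abar * abar * (2 * (S * m) / (1 - κ) * (2 * (S * m) / (1 - κ))) := by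
          gcongr
      _ = _ := by ring
  have hG := h.picard (n + 3)
  rw [hu] at hG ⊢
  have main := SteadyNSE.norm_grad_residual_le hd hb hM hν hbound hκ hs (h.picard n)
    (h.picard (n + 1)) (h.picard (n + 2)) hG
  refine main.trans ?_
  have p1 := pair h0 h1 (hm0.trans hmS) (hm1.trans hmS)
  have p2 := pair h0 h2 (hm0.trans hmS) hk
  have p3 := pair h1 h2 (hm1.trans hmS) hk
  rw [mul_assoc κ, hg]
  refine add_le_add le_rfl ?_
  -- The factor `3` in the constant counts the pairs of indices.
  rw [remainderConst, mul_assoc (M / ν)]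
  gcongr
  linarith

theorem remainderConst_nonneg {M ν κ abar abreve : ℝ} (hM : 0 < M) (hν : 0 < ν) :
    0 ≤ remainderConst M ν κ abar abreve := by
  unfold remainderConst
  positivity

end SteadyNSE

end

open SteadyNSE in
theorem theorem4p2 :
    (∀ d : ℕ, d = 2 ∨ d = 3 → ∀ Ω : Set (E d), IsOpen Ω → Bornology.IsBounded Ω →
      ∃ M : ℝ, 0 < M ∧ IsBStarBound Ω M) ∧
    ∀ M ν κ abar abreve : ℝ, 0 < M → 0 < ν → κ < 1 → 0 < abreve →
      ∃ C : ℝ, 0 ≤ C ∧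
        ∀ d : ℕ, d = 2 ∨ d = 3 → ∀ Ω : Set (E d), IsOpen Ω → Bornology.IsBounded Ω →
          IsBStarBound Ω M →
        ∀ f : H10 Ω →L[ℝ] ℝ, κ = M * (ν ^ 2)⁻¹ * dualNorm f →
        ∀ (Xh : Submodule ℝ (H10 Ω)) (Qh : Submodule ℝ (L2Scal Ω)), IsDiscretePair Xh Qh →
        ∀ (u ut : ℕ → H10 Ω) (α : ℕ → ℕ → ℝ),
          IsAndersonPicard 2 ν f (discDivFree Xh Qh) u ut α →
        ∀ k : ℕ, 2 ≤ k →
          |α (k + 1) (k - 2)| ≤ abar → |α (k + 1) (k - 1)| ≤ abar → |α (k + 1) k| ≤ abar →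
          abreve < |α (k + 1) k| →
          α (k + 1) (k - 2) < α (k + 1) k →
          (α (k + 1) (k - 2) ≠ 0 ∨ α (k + 1) (k - 1) ≠ 0) →
          (∃ θ : ℝ, 0 ≤ θ ∧ θ ≤ 1 ∧ IsGain 2 u ut k θ) ∧
          ∀ θ : ℝ, IsGain 2 u ut k θ →
            ‖grad (ut (k + 2) - u (k + 1))‖ ≤
                κ * θ * ‖grad (ut (k + 1) - u k)‖ +
                  C * (max ‖grad (ut (k - 1) - u (k - 2))‖ ‖grad (ut k - u (k - 1))‖) ^ 2 ∧
            ∀ K : ℝ, 1 ≤ K →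
              ‖grad (ut k - u (k - 1))‖ ≤ K * ‖grad (ut (k - 1) - u (k - 2))‖ →
              ‖grad (ut (k + 2) - u (k + 1))‖ ≤
                κ * θ * ‖grad (ut (k + 1) - u k)‖ +
                  C * K ^ 2 * ‖grad (ut (k - 1) - u (k - 2))‖ ^ 2 := by
  refine ⟨fun d hd Ω _ hb => exists_isBStarBound hd hb, ?_⟩
  intro M ν κ abar abreve hM hν hκ1 habr
  have hC := remainderConst_nonneg (κ := κ) (abar := abar) (abreve := abreve) hM hν
  refine ⟨remainderConst M ν κ abar abreve, hC, ?_⟩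
  intro d hd Ω _ hb hbound f hκ Xh Qh _ u ut α h k hk h0 h1 h2 h3 _ _
  -- Writing `k = n + 2` resolves the truncated subtractions `k - 2` and `k - 1`.
  obtain ⟨n, rfl⟩ := Nat.exists_eq_add_of_le' hk
  refine ⟨h.exists_isGain _, fun θ hθ => ?_⟩
  have main := IsAndersonPicard.norm_grad_residual_le hd hb hM hν hκ1 habr hbound hκ
    (V := discDivFreeSubmodule Xh Qh) h h0 h1 h2 h3 hθ
  refine ⟨main, fun K hK hle => main.trans (add_le_add le_rfl ?_)⟩
  rw [mul_assoc, ← mul_pow]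
  refine mul_le_mul_of_nonneg_left (pow_le_pow_left₀ (le_max_of_le_left (norm_nonneg _)) ?_ 2) hC
  exact max_le (le_mul_of_one_le_left (norm_nonneg _) hK) hle
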